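/- Let $\sigma>0$ and $\varepsilon\ge 0$ be fixed. For every $d\ge 1$ let $\mu^{(d)}=(\mu_1,\dots,\mu_d)\in\mathbb R^d$ (the $\mu_k=\mu^{(d)}_k$ may depend on $d$) and let $N_1,\dots,N_d$ be independent $\mathcal N(0,\sigma^2)$ random variables. Put $g_\varepsilon(x)=\operatorname{sign}(x)\max(0,|x|-\varepsilon)$, applied coordinate-wise to vectors, with $\operatorname{sign}(0)=0$. Consider the GLRT rule for the class means $\pm\mu^{(d)}$, which compares the costs $C_0=\|g_\varepsilon(X-\mu^{(d)})\|_2^2$ and $C_1=\|g_\varepsilon(X+\mu^{(d)})\|_2^2$, for the observation $X=\mu^{(d)}-\varepsilon\operatorname{sign}(\mu^{(d)})+N$ (true mean $\mu^{(d)}$, attack $-\varepsilon\operatorname{sign}(\mu^{(d)})$), and its error probability $P_e^{(d)}=P(C_1<C_0)$. Let $$C[k]=g_\varepsilon(2\mu_k-\varepsilon\operatorname{sign}(\mu_k)+N_k)^2-g_\varepsilon(-\varepsilon\operatorname{sign}(\mu_k)+N_k)^2,$$ so that $C_1-C_0=\sum_{k\le d} C[k]$, and $$Y_k=\mathbb 1_{\{N_k\ge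 -t_k\}}(t_k+N_k)^2-N_k^2,\qquad t_k=2(|\mu_k|-\varepsilon).$$ For a family $Z_1,\dots,Z_d$ of square-integrable random variables (given for every $d$) write $m_k=\mathbb E Z_k$ and $s_d^2=\sum_{k\le d}\operatorname{Var}(Z_k)$. Lindeberg's condition says that $s_d>0$ for all large $d$ and that, for every $\delta>0$, $$\lim_{d\to\infty}\frac1{s_d^2}\sum_{k=1}^d\mathbb E\big[(Z_k-m_k)^2\mathbb 1_{\{|Z_k-m_k|\ge\delta s_d\}}\big]=0;$$ the CLT says that $s_d^{-1}\sum_{k\le d}(Z_k-m_k)$ converges in distribution to $\mathcal N(0,1)$. Let $Q(x)=P(\mathcal N(0,1)>x)$. Then: 1. For every $d$ the variables $Y_1,\dots,Y_d$ are independent, and $P_e^{(d)}\le P\big(\sum_{k\le d}Y_k<0\big)$. 2. If the $Y_k$ satisfy Lindeberg's condition, then the CLT holds for them. 3. If the $|\mu_k|$ are bounded uniformly in $k$ and $d$, then the $Y_k$ do satisfy Lindeberg's condition, hence the CLT, and the CLT approximation is asymptotically exact: $P\big(\sum_{k\le d}Y_k<0\big)-Q\big(\sum_{k\le d}\mathbb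 E Y_k/\sqrt{\sum_{k\le d}\operatorname{Var}Y_k}\big)\to0$ as $d\to\infty$. 4. If in addition $\|\mu^{(d)}\|_2\to\infty$ as $d\to\infty$ (for instance if $\varepsilon>0$ and $|\mu_k|>\varepsilon$ for all $k$), then also the cost differences $C[k]$ satisfy Lindeberg's condition and the CLT, and $P_e^{(d)}-Q\big(\sum_{k\le d}\mathbb E C[k]/\sqrt{\sum_{k\le d}\operatorname{Var}C[k]}\big)\to0$ as $d\to\infty$. -/

import Mathlib

open MeasureTheory ProbabilityTheory Filter Topology

noncomputable section

namespace GLRT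

/-- The double-sided ReLU `g_ε(x) = sign(x) max(0, |x| - ε)`. -/
def doubleSidedReLU (ε x : ℝ) : ℝ := Real.sign x * max 0 (|x| - ε)

/-- The complementary distribution function `Q` of the standard Gaussian distribution. -/
def gaussQ (x : ℝ) : ℝ := (gaussianReal 0 1).real (Set.Ioi x)

/-- The GLRT cost `‖g_ε(x - c)‖²` of the observation `x` for the hypothesis with class mean `c`,
where `g_ε` acts coordinate-wise and the norm is the Euclidean one. -/
def cost {d : ℕ} (ε : ℝ) (x c : Fin d → ℝ) : ℝ := ∑ k, doubleSidedReLU ε (x k - c k) ^ 2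

/-- The observation `μ - ε sign(μ) + n` under the hypothesis with class mean `μ`,
the attack `-ε sign(μ)` and the noise `n`. -/
def observation {d : ℕ} (ε : ℝ) (μ n : Fin d → ℝ) : Fin d → ℝ :=
  fun k => μ k - ε * Real.sign (μ k) + n k

/-- Contribution `C[k] = C₁[k] - C₀[k]` of one coordinate, with mean `μ` and noise `n`, to the
difference of the GLRT costs for the class means `-μ` and `μ`, under the attack `-ε sign(μ)`. -/
def coordCostDiff (ε μ n : ℝ) : ℝ :=
  doubleSidedReLU ε (2 * μ - ε * Real.sign μ + n) ^ 2 -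
    doubleSidedReLU ε (-(ε * Real.sign μ) + n) ^ 2

/-- `t = 2 (|μ| - ε)`. -/
def shift (ε μ : ℝ) : ℝ := 2 * (|μ| - ε)

/-- The lower-bounding expression `1{n ≥ -t} (t + n)² - n²`. -/
def coordLower (ε μ n : ℝ) : ℝ :=
  (if -shift ε μ ≤ n then (shift ε μ + n) ^ 2 else 0) - n ^ 2

section Array

variable {Ω : ℕ → Type*} [∀ d, MeasurableSpace (Ω d)]

/-- The random variables `Y_k`, `k < d`, in every dimension `d`. -/
def lowerVar (ε : ℝ) (μ : ∀ d, Fin d → ℝ) (N : ∀ d, Fin d → Ω d → ℝ) :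
    ∀ d, Fin d → Ω d → ℝ :=
  fun d k ω => coordLower ε (μ d k) (N d k ω)

/-- The random variables `C[k]`, `k < d`, in every dimension `d`. -/
def costDiffVar (ε : ℝ) (μ : ∀ d, Fin d → ℝ) (N : ∀ d, Fin d → Ω d → ℝ) :
    ∀ d, Fin d → Ω d → ℝ :=
  fun d k ω => coordCostDiff ε (μ d k) (N d k ω)

/-- The error probability `P(C₁ < C₀)` of the GLRT rule in dimension `d`, given the class with
mean `μ`, the other class having mean `-μ`, under the attack `-ε sign(μ)`. -/
def errorProb (P : ∀ d, Measure (Ω d)) (ε : ℝ) (μ : ∀ d, Fin d → ℝ)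
    (N : ∀ d, Fin d → Ω d → ℝ) (d : ℕ) : ℝ :=
  (P d).real {ω | cost ε (observation ε (μ d) (fun k => N d k ω)) (fun k => -μ d k) <
    cost ε (observation ε (μ d) (fun k => N d k ω)) (μ d)}

/-- The probability that the sum of the `d`-th row is negative. -/
def negSumProb (P : ∀ d, Measure (Ω d)) (Z : ∀ d, Fin d → Ω d → ℝ) (d : ℕ) : ℝ :=
  (P d).real {ω | ∑ k, Z d k ω < 0}

/-- The sum `∑ k, m_k` of the means of the `d`-th row. -/
def sumMean (P : ∀ d, Measure (Ω d)) (Z : ∀ d, Fin d → Ω d → ℝ) (d : ℕ) : ℝ :=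
  ∑ k, ∫ ω, Z d k ω ∂(P d)

/-- The sum `s_d² = ∑ k, ρ_k²` of the variances of the `d`-th row. -/
def sumVar (P : ∀ d, Measure (Ω d)) (Z : ∀ d, Fin d → Ω d → ℝ) (d : ℕ) : ℝ :=
  ∑ k, variance (Z d k) (P d)

/-- `s_d`, the square root of the sum of the variances of the `d`-th row. -/
def sumStd (P : ∀ d, Measure (Ω d)) (Z : ∀ d, Fin d → Ω d → ℝ) (d : ℕ) : ℝ :=
  √(sumVar P Z d)

/-- Lindeberg's condition. The first two fields say that the quantities in the third one make
sense: all variances are finite, and `s_d ≠ 0` for large `d`. -/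
structure Lindeberg (P : ∀ d, Measure (Ω d)) (Z : ∀ d, Fin d → Ω d → ℝ) : Prop where
  memLp_two : ∀ d k, MemLp (Z d k) 2 (P d)
  sumVar_pos : ∀ᶠ d in atTop, 0 < sumVar P Z d
  tendsto_zero : ∀ δ : ℝ, 0 < δ →
    Tendsto (fun d => 1 / sumVar P Z d * ∑ k,
      ∫ ω, Set.indicator {ω | δ * sumStd P Z d ≤ |Z d k ω - ∫ ω', Z d k ω' ∂(P d)|}
        (fun ω => (Z d k ω - ∫ ω', Z d k ω' ∂(P d)) ^ 2) ω ∂(P d)) atTop (𝓝 0)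

/-- The central limit theorem holds for the row sums: `(∑ k, Z_k - ∑ k, m_k) / s_d` converges in
distribution to the standard Gaussian distribution. -/
def CLT (P : ∀ d, Measure (Ω d)) [∀ d, IsProbabilityMeasure (P d)]
    (Z : ∀ d, Fin d → Ω d → ℝ) : Prop :=
  TendstoInDistribution (fun d ω => (∑ k, Z d k ω - sumMean P Z d) / sumStd P Z d) atTop
    (id : ℝ → ℝ) P (gaussianReal 0 1)

/-- The CLT approximation `Q (∑ k, m_k / s_d)` of the probability that the row sum is negative. -/
def cltApprox (P : ∀ d, Measure (Ω d)) (Z : ∀ d, Fin d → Ω d → ℝ) (d : ℕ) : ℝ :=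
  gaussQ (sumMean P Z d / sumStd P Z d)

end Array

end GLRT

end

/-!
# Gaussian approximation of the GLRT error probability

The row sums are sums of independent random variables that depend on a Gaussian noise variable
through a function of quadratic growth, so that the limit statements follow from Lindeberg's central
limit theorem for triangular arrays, which is proved here with characteristic functions
(`norm_charFun_sum_sub_le`, `Lindeberg.clt`).

*Lindeberg's condition* is checked with fourth moments (`lindeberg_of_fourth_moment_le`). For the
lower bounds `Y_k` with bounded means, the fourth central moments are bounded, and the variances are
bounded below, because far to the left `Y_k = -N_k²` does not depend on the mean any more
(`lindeberg_lowerVar`). For the cost differences `C[k]` nothing of the sort holds uniformly, as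
`C[k] = 0` when `μ_k = 0`. But `|C[k]|` is at most a constant times `|μ_k| (1 + N_k²)`, and for
`N_k ≥ 2 ε` and `μ_k > 0` one has `C[k] = 4 μ_k (μ_k + N_k - 2 ε)`, so that the variance is at least
a constant times `μ_k²` and the fourth central moment at most a constant times it
(`lindeberg_costDiffVar`). Hence the assumption that `∑ μ_k²` diverges.

*From the CLT to the probabilities*: the argument of `Q` varies with the dimension, so convergence
in distribution is used uniformly in the threshold, by Pólya's theorem
(`tendsto_sub_cdf_of_tendsto`).

*The bound on the error probability*: for `μ ≥ 0` the cost difference dominates the lower bound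
pointwise (`coordLower_le_coordCostDiff`). The cost difference is unchanged when mean and noise of a
coordinate are reflected together, while the lower bound depends on `|μ|` only, and the joint law of
the noise is invariant under reflections of coordinates. This reduces the general case to
nonnegative means.
-/

namespace GLRT

/-! ### Lindeberg's central limit theorem -/

/-- Both bounds for the remainder are needed: the cubic one where the variable is small, the
quadratic one on the tails, where only second moments are available. -/
lemma norm_exp_mul_I_sub_taylor_le (x : ℝ) :
    ‖Complex.exp (x * Complex.I) - (1 + x * Complex.I - x ^ 2 / 2)‖ ≤ 4 * x ^ 2 * min 1 |x| := by
  rcases le_or_gt |x| 1 with hx | hx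
  · have h := Complex.exp_bound (x := x * Complex.I) (by simpa using hx) (n := 3) (by norm_num)
    have e : ∑ m ∈ Finset.range 3, (x * Complex.I) ^ m / (m.factorial : ℂ)
        = 1 + x * Complex.I - x ^ 2 / 2 := by
      simp only [Finset.sum_range_succ, Finset.range_zero, Finset.sum_empty, Nat.factorial, mul_pow,
        Complex.I_sq]
      push_cast
      ring
    rw [e] at h
    rw [min_eq_right hx]
    refine h.trans ?_
    have h3 : |x| ^ 3 = x ^ 2 * |x| := by rw [pow_succ, sq_abs]
    have h0 : 0 ≤ x ^ 2 * |x| := by positivity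
    simp only [norm_mul, Complex.norm_real, Complex.norm_I, mul_one, Real.norm_eq_abs, h3,
      Nat.factorial]
    norm_num
    linarith
  · rw [min_eq_left hx.le]
    have h1 : ‖Complex.exp (x * Complex.I)‖ = 1 := Complex.norm_exp_ofReal_mul_I x
    have h2 : ‖(1 + x * Complex.I - x ^ 2 / 2 : ℂ)‖ ≤ 1 + |x| + x ^ 2 / 2 := by
      refine (norm_sub_le _ _).trans (add_le_add ((norm_add_le _ _).trans (by simp)) (by simp))
    have h3 : 1 ≤ x ^ 2 := by rw [← sq_abs]; nlinarith
    have h4 : |x| ≤ x ^ 2 := by rw [← sq_abs]; nlinarith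
    refine (norm_sub_le _ _).trans ?_
    linarith

/-- Factors in the closed unit disc may be replaced one at a time. -/
lemma norm_prod_sub_prod_le {ι : Type*} (s : Finset ι) (a b : ι → ℂ) (ha : ∀ i, ‖a i‖ ≤ 1)
    (hb : ∀ i, ‖b i‖ ≤ 1) : ‖∏ i ∈ s, a i - ∏ i ∈ s, b i‖ ≤ ∑ i ∈ s, ‖a i - b i‖ := by
  classical
  induction s using Finset.induction_on with
  | empty => simp
  | insert i s hi ih =>
    rw [Finset.prod_insert hi, Finset.prod_insert hi, Finset.sum_insert hi]
    have e : a i * ∏ j ∈ s, a j - b i * ∏ j ∈ s, b j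
        = (a i - b i) * ∏ j ∈ s, a j + b i * (∏ j ∈ s, a j - ∏ j ∈ s, b j) := by ring
    rw [e]
    refine (norm_add_le _ _).trans (add_le_add ?_ ?_)
    · rw [norm_mul, norm_prod]
      exact mul_le_of_le_one_right (norm_nonneg _)
        (Finset.prod_le_one (fun _ _ => norm_nonneg _) fun _ _ => ha _)
    · rw [norm_mul]
      exact (mul_le_of_le_one_left (norm_nonneg _) (hb i)).trans ih

section CharFun

variable {Ω : Type*} [MeasurableSpace Ω] {P : Measure Ω}

/-- Truncated second moment `E[X² 1{|X| ≥ δ}]`, the summand of Lindeberg's condition. -/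
noncomputable def tailSecondMoment (P : Measure Ω) (X : Ω → ℝ) (δ : ℝ) : ℝ :=
  ∫ ω, Set.indicator {ω | δ ≤ |X ω|} (fun ω => X ω ^ 2) ω ∂P

lemma integrable_indicator_sq {X : Ω → ℝ} (hX : MemLp X 2 P) (δ : ℝ) :
    Integrable (Set.indicator {ω | δ ≤ |X ω|} fun ω => X ω ^ 2) P := by
  have hm : AEMeasurable (fun ω => |X ω|) P :=
    continuous_abs.measurable.comp_aemeasurable hX.aestronglyMeasurable.aemeasurable
  exact hX.integrable_sq.indicator₀ (nullMeasurableSet_le aemeasurable_const hm)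

lemma tailSecondMoment_nonneg (X : Ω → ℝ) (δ : ℝ) : 0 ≤ tailSecondMoment P X δ :=
  integral_nonneg fun _ => Set.indicator_nonneg (fun _ _ => sq_nonneg _) _

variable [IsProbabilityMeasure P]

/-- Second order expansion of the characteristic function of a centred variable. The cubic bound of
the Taylor remainder is used on `{|X| < δ}` and the quadratic one on `{|X| ≥ δ}`. -/
lemma norm_charFun_sub_le {X : Ω → ℝ} (hX : MemLp X 2 P) (h0 : ∫ ω, X ω ∂P = 0) (t δ : ℝ)
    (hδ : 0 ≤ δ) :
    ‖charFun (P.map X) t - ((1 - t ^ 2 / 2 * ∫ ω, X ω ^ 2 ∂P : ℝ) : ℂ)‖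
      ≤ 4 * t ^ 2 * (|t| * δ * ∫ ω, X ω ^ 2 ∂P) + 4 * t ^ 2 * tailSecondMoment P X δ := by
  have hm := hX.aestronglyMeasurable.aemeasurable
  have hi := hX.integrable_sq
  have hi1 : Integrable X P := hX.integrable (by norm_num)
  have hiE : Integrable (fun ω => Complex.exp (↑(t * X ω) * Complex.I)) P := by
    refine Integrable.of_bound (C := 1) ?_ (ae_of_all _ fun ω => ?_)
    · have : Continuous fun x : ℝ => Complex.exp (↑(t * x) * Complex.I) := by fun_prop
      exact (this.measurable.comp_aemeasurable hm).aestronglyMeasurable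
    · rw [Complex.norm_exp_ofReal_mul_I]
  have hiP1 : Integrable (fun ω => ((t * X ω : ℝ) : ℂ) * Complex.I) P :=
    ((hi1.const_mul t).ofReal).mul_const _
  have hiP2 : Integrable (fun ω => (((t * X ω : ℝ) : ℂ)) ^ 2 / 2) P := by
    have : Integrable (fun ω => ((((t ^ 2 / 2) * X ω ^ 2 : ℝ)) : ℂ)) P := (hi.const_mul _).ofReal
    refine this.congr (ae_of_all _ fun ω => ?_)
    push_cast
    ring
  have hiP3 : Integrable (fun ω => 1 + ((t * X ω : ℝ) : ℂ) * Complex.I) P :=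
    (integrable_const _).add hiP1
  have hiP : Integrable (fun ω => 1 + ((t * X ω : ℝ) : ℂ) * Complex.I
      - (((t * X ω : ℝ) : ℂ)) ^ 2 / 2) P := hiP3.sub hiP2
  have e1 : charFun (P.map X) t = ∫ ω, Complex.exp (↑(t * X ω) * Complex.I) ∂P := by
    rw [charFun_apply_real, integral_map hm (by fun_prop)]
    push_cast
    rfl
  have e2 : ((1 - t ^ 2 / 2 * ∫ ω, X ω ^ 2 ∂P : ℝ) : ℂ)
      = ∫ ω, (1 + ((t * X ω : ℝ) : ℂ) * Complex.I - (((t * X ω : ℝ) : ℂ)) ^ 2 / 2) ∂P := by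
    rw [integral_sub hiP3 hiP2, integral_add (integrable_const _) hiP1,
      integral_mul_const, integral_complex_ofReal, integral_const_mul, h0]
    have : ∫ ω, (((t * X ω : ℝ) : ℂ)) ^ 2 / 2 ∂P = ((t ^ 2 / 2 * ∫ ω, X ω ^ 2 ∂P : ℝ) : ℂ) := by
      rw [← integral_const_mul, ← integral_complex_ofReal]
      refine integral_congr_ae (ae_of_all _ fun ω => ?_)
      push_cast
      ring
    rw [this]
    simp
  have hb := integrable_indicator_sq hX δ
  rw [e1, e2, ← integral_sub hiE hiP, tailSecondMoment, ← integral_const_mul, ← integral_const_mul,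
    ← integral_const_mul, ← integral_add ((hi.const_mul _).const_mul _) (hb.const_mul _)]
  refine norm_integral_le_of_norm_le (((hi.const_mul _).const_mul _).add (hb.const_mul _))
    (ae_of_all _ fun ω => (norm_exp_mul_I_sub_taylor_le _).trans ?_)
  rw [mul_pow, abs_mul]
  by_cases h : δ ≤ |X ω|
  · rw [Set.indicator_of_mem (by exact h)]
    have h1 : min 1 (|t| * |X ω|) ≤ 1 := min_le_left _ _
    have h2 : 0 ≤ t ^ 2 * X ω ^ 2 := by positivity
    have h3 : 0 ≤ 4 * t ^ 2 * (|t| * δ * X ω ^ 2) := by positivity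
    nlinarith
  · rw [Set.indicator_of_notMem (by exact h)]
    have h1 : min 1 (|t| * |X ω|) ≤ |t| * δ :=
      (min_le_right _ _).trans (mul_le_mul_of_nonneg_left (not_le.1 h).le (abs_nonneg _))
    have h2 : 0 ≤ t ^ 2 * X ω ^ 2 := by positivity
    nlinarith

lemma integral_sq_le_add_tailSecondMoment {X : Ω → ℝ} (hX : MemLp X 2 P) (δ : ℝ) :
    ∫ ω, X ω ^ 2 ∂P ≤ δ ^ 2 + tailSecondMoment P X δ := by
  have hb := integrable_indicator_sq hX δ
  have e : δ ^ 2 + tailSecondMoment P X δ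
      = ∫ ω, (δ ^ 2 + Set.indicator {ω | δ ≤ |X ω|} (fun ω => X ω ^ 2) ω) ∂P := by
    rw [integral_add (integrable_const _) hb]
    simp [tailSecondMoment]
  rw [e]
  refine integral_mono hX.integrable_sq ((integrable_const _).add hb) fun ω => ?_
  by_cases h : δ ≤ |X ω|
  · simp only [Set.indicator_of_mem (show ω ∈ {ω | δ ≤ |X ω|} from h)]
    nlinarith [sq_nonneg δ]
  · simp only [Set.indicator_of_notMem (show ω ∉ {ω | δ ≤ |X ω|} from h)]
    rw [← sq_abs (X ω)]
    nlinarith [not_le.1 h, abs_nonneg (X ω)]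

lemma norm_one_sub_sub_exp_neg_le {u : ℝ} (hu : 0 ≤ u) :
    ‖((1 - u : ℝ) : ℂ) - (Real.exp (-u) : ℝ)‖ ≤ u ^ 2 := by
  rw [← Complex.ofReal_sub, Complex.norm_real, Real.norm_eq_abs, abs_sub_comm]
  rcases le_or_gt u 1 with h | h
  · have := Real.abs_exp_sub_one_sub_id_le (x := -u) (by rwa [abs_neg, abs_of_nonneg hu])
    rw [neg_sq] at this
    convert this using 2
    ring
  · rw [abs_le]
    constructor
    · nlinarith [Real.exp_pos (-u)]
    · nlinarith [Real.exp_le_one_iff.2 (neg_nonpos.2 hu)]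

/-- Quantitative form of Lindeberg's theorem: the `k`-th characteristic function is compared with
`1 - t² v k / 2`, and that with `exp (-t² v k / 2)`, where `v k = E[X k ²]`. -/
lemma norm_charFun_sum_sub_le {ι : Type*} [Fintype ι] {X : ι → Ω → ℝ} (hind : iIndepFun X P)
    (hX : ∀ k, MemLp (X k) 2 P) (h0 : ∀ k, ∫ ω, X k ω ∂P = 0) (h1 : ∑ k, ∫ ω, X k ω ^ 2 ∂P = 1)
    (t δ : ℝ) (hδ : 0 ≤ δ) :
    ‖charFun (P.map fun ω => ∑ k, X k ω) t - (Real.exp (-(t ^ 2 / 2)) : ℝ)‖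
      ≤ 4 * t ^ 2 * (|t| * δ) + 4 * t ^ 2 * (∑ k, tailSecondMoment P (X k) δ)
        + (t ^ 2 / 2) ^ 2 * (δ ^ 2 + ∑ k, tailSecondMoment P (X k) δ) := by
  have hm k : AEMeasurable (X k) P := (hX k).aestronglyMeasurable.aemeasurable
  have hP k : IsProbabilityMeasure (P.map (X k)) := Measure.isProbabilityMeasure_map (hm k)
  rw [hind.charFun_map_fun_sum_eq_prod hm, Finset.prod_apply]
  have hv k : 0 ≤ ∫ ω, X k ω ^ 2 ∂P := integral_nonneg fun _ => sq_nonneg _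
  have e : ((Real.exp (-(t ^ 2 / 2)) : ℝ) : ℂ)
      = ∏ k, ((Real.exp (-(t ^ 2 / 2 * ∫ ω, X k ω ^ 2 ∂P)) : ℝ) : ℂ) := by
    rw [← Complex.ofReal_prod, ← Real.exp_sum, Finset.sum_neg_distrib, ← Finset.mul_sum, h1,
      mul_one]
  have hmax k : ∫ ω, X k ω ^ 2 ∂P ≤ δ ^ 2 + ∑ k, tailSecondMoment P (X k) δ :=
    (integral_sq_le_add_tailSecondMoment (hX k) δ).trans <| by
      gcongr
      exact Finset.single_le_sum (f := fun k => tailSecondMoment P (X k) δ)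
        (fun _ _ => tailSecondMoment_nonneg _ _) (Finset.mem_univ k)
  rw [e]
  refine (norm_prod_sub_prod_le _ _ _ (fun k => norm_charFun_le_one _) fun k => ?_).trans ?_
  · rw [Complex.norm_real, Real.norm_eq_abs, abs_of_pos (Real.exp_pos _), Real.exp_le_one_iff]
    exact neg_nonpos.2 (mul_nonneg (by positivity) (hv k))
  calc _ ≤ ∑ k, (4 * t ^ 2 * (|t| * δ * ∫ ω, X k ω ^ 2 ∂P) + 4 * t ^ 2 * tailSecondMoment P (X k) δ
        + (t ^ 2 / 2) ^ 2 * ((δ ^ 2 + ∑ k, tailSecondMoment P (X k) δ)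
          * ∫ ω, X k ω ^ 2 ∂P)) := by
        refine Finset.sum_le_sum fun k _ => ?_
        refine (norm_sub_le_norm_sub_add_norm_sub _
          ((1 - t ^ 2 / 2 * ∫ ω, X k ω ^ 2 ∂P : ℝ) : ℂ) _).trans (add_le_add
          (norm_charFun_sub_le (hX k) (h0 k) t δ hδ)
          ((norm_one_sub_sub_exp_neg_le (mul_nonneg (by positivity) (hv k))).trans ?_))
        rw [mul_pow, sq (∫ ω, X k ω ^ 2 ∂P)]
        gcongr
        · exact hmax k
    _ = _ := by
        simp only [Finset.sum_add_distrib, ← Finset.mul_sum, h1, mul_one]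

end CharFun

section TriangularArray

variable {Ω : ℕ → Type*} [∀ d, MeasurableSpace (Ω d)] {P : ∀ d, Measure (Ω d)}
  {Z : ∀ d, Fin d → Ω d → ℝ}

lemma sumVar_nonneg (d : ℕ) : 0 ≤ sumVar P Z d :=
  Finset.sum_nonneg fun _ _ => variance_nonneg _ _

variable [∀ d, IsProbabilityMeasure (P d)]

lemma tailSecondMoment_div {Ω : Type*} [MeasurableSpace Ω] {P : Measure Ω} (X : Ω → ℝ)
    {s : ℝ} (hs : 0 < s) (δ : ℝ) :
    tailSecondMoment P (fun ω => X ω / s) δ = 1 / s ^ 2 * tailSecondMoment P X (δ * s) := by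
  rw [tailSecondMoment, tailSecondMoment, ← integral_const_mul]
  refine integral_congr_ae (ae_of_all _ fun ω => ?_)
  have h : δ ≤ |X ω / s| ↔ δ * s ≤ |X ω| := by rw [abs_div, abs_of_pos hs, le_div_iff₀ hs]
  simp only [Set.indicator, Set.mem_ofPred_eq, h]
  split_ifs
  · rw [div_pow]; ring
  · simp

/-- `norm_charFun_sum_sub_le` for the centred row sum divided by its standard deviation, with the
truncation at `δ s_d` as in Lindeberg's condition. -/
lemma norm_charFun_standardized_sub_le {d : ℕ} (hind : iIndepFun (Z d) (P d))
    (hZ : ∀ k, MemLp (Z d k) 2 (P d)) (hpos : 0 < sumVar P Z d) (t δ : ℝ) (hδ : 0 ≤ δ) :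
    ‖charFun ((P d).map fun ω => (∑ k, Z d k ω - sumMean P Z d) / sumStd P Z d) t
        - (Real.exp (-(t ^ 2 / 2)) : ℝ)‖
      ≤ 4 * t ^ 2 * (|t| * δ) + 4 * t ^ 2 * (1 / sumVar P Z d * ∑ k,
          tailSecondMoment (P d) (fun ω => Z d k ω - ∫ ω', Z d k ω' ∂(P d)) (δ * sumStd P Z d))
        + (t ^ 2 / 2) ^ 2 * (δ ^ 2 + 1 / sumVar P Z d * ∑ k,
          tailSecondMoment (P d) (fun ω => Z d k ω - ∫ ω', Z d k ω' ∂(P d))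
            (δ * sumStd P Z d)) := by
  have hs : 0 < sumStd P Z d := Real.sqrt_pos.2 hpos
  have hs2 : sumStd P Z d ^ 2 = sumVar P Z d := Real.sq_sqrt hpos.le
  have hL k : MemLp (fun ω => (Z d k ω - ∫ ω', Z d k ω' ∂(P d)) / sumStd P Z d) 2 (P d) := by
    simpa only [div_eq_mul_inv, Pi.sub_apply] using ((hZ k).sub (memLp_const _)).mul_const _
  have h := norm_charFun_sum_sub_le
    (X := fun k ω => (Z d k ω - ∫ ω', Z d k ω' ∂(P d)) / sumStd P Z d)
    (hind.comp (fun k x => (x - ∫ ω', Z d k ω' ∂(P d)) / sumStd P Z d) fun k => by fun_prop)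
    hL (fun k => ?_) ?_ t δ hδ
  · simp only [tailSecondMoment_div _ hs, ← Finset.mul_sum, hs2] at h
    simpa only [← Finset.sum_div, Finset.sum_sub_distrib, sumMean] using h
  · rw [integral_div, integral_sub ((hZ k).integrable (by norm_num)) (integrable_const _)]
    simp
  · have e k : ∫ ω, ((Z d k ω - ∫ ω', Z d k ω' ∂(P d)) / sumStd P Z d) ^ 2 ∂(P d)
        = variance (Z d k) (P d) / sumVar P Z d := by
      simp only [div_pow, hs2]
      rw [integral_div, variance_eq_integral (hZ k).aestronglyMeasurable.aemeasurable]
    simp only [e, ← Finset.sum_div]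
    exact div_self hpos.ne'

/-- **Lindeberg's central limit theorem** for triangular arrays with independent rows. -/
theorem Lindeberg.clt (h : Lindeberg P Z) (hind : ∀ d, iIndepFun (Z d) (P d)) : CLT P Z := by
  have hm d : AEMeasurable (fun ω => (∑ k, Z d k ω - sumMean P Z d) / sumStd P Z d) (P d) :=
    ((Finset.aemeasurable_fun_sum _ fun k _ =>
      (h.memLp_two d k).aestronglyMeasurable.aemeasurable).sub_const _).div_const _
  refine ⟨hm, aemeasurable_id, ProbabilityMeasure.tendsto_iff_tendsto_charFun.2 fun t => ?_⟩
  have hlim : charFun ((gaussianReal 0 1).map id) t = (Real.exp (-(t ^ 2 / 2)) : ℝ) := by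
    rw [Measure.map_id, charFun_gaussianReal]
    push_cast
    congr 1
    simp
  simp only [ProbabilityMeasure.coe_mk, hlim]
  rw [Metric.tendsto_nhds]
  intro η hη
  -- The Lindeberg quotient is negligible for every fixed `δ`, and the rest of the bound is small
  -- with `δ`.
  have hc : Tendsto (fun δ : ℝ => 4 * t ^ 2 * (|t| * δ) + (t ^ 2 / 2) ^ 2 * δ ^ 2)
      (𝓝[>] 0) (𝓝 0) := by
    have : Continuous fun δ : ℝ => 4 * t ^ 2 * (|t| * δ) + (t ^ 2 / 2) ^ 2 * δ ^ 2 := by fun_prop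
    simpa using (this.tendsto 0).mono_left nhdsWithin_le_nhds
  obtain ⟨δ, hδη, hδ⟩ := ((hc.eventually_lt_const (half_pos hη)).and self_mem_nhdsWithin).exists
  have hδ : 0 < δ := hδ
  have hL := ((h.tendsto_zero δ hδ).const_mul (4 * t ^ 2 + (t ^ 2 / 2) ^ 2))
  rw [mul_zero] at hL
  filter_upwards [hL.eventually_lt_const (half_pos hη), h.sumVar_pos] with d hd hpos
  rw [dist_eq_norm]
  refine (norm_charFun_standardized_sub_le (hind d) (h.memLp_two d) hpos t δ hδ.le).trans_lt ?_
  simp only [tailSecondMoment]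
  linarith

/-- Lyapunov's criterion with fourth moments: both the variances and the fourth central moments
are compared with nonnegative weights `w d k` whose row sums diverge. -/
theorem lindeberg_of_fourth_moment_le (hZ : ∀ d k, MemLp (Z d k) 2 (P d))
    {w : ∀ d, Fin d → ℝ} (hw : Tendsto (fun d => ∑ k, w d k) atTop atTop)
    {c K : ℝ} (hc : 0 < c) (hvar : ∀ d k, c * w d k ≤ variance (Z d k) (P d))
    (hint : ∀ d k, Integrable (fun ω => (Z d k ω - ∫ ω', Z d k ω' ∂(P d)) ^ 4) (P d))
    (hK : ∀ d k, ∫ ω, (Z d k ω - ∫ ω', Z d k ω' ∂(P d)) ^ 4 ∂(P d) ≤ K * w d k) :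
    Lindeberg P Z := by
  have hsum d : c * ∑ k, w d k ≤ sumVar P Z d := by
    rw [Finset.mul_sum]
    exact Finset.sum_le_sum fun k _ => hvar d k
  refine ⟨hZ, ?_, fun δ hδ => ?_⟩
  · filter_upwards [hw.eventually_gt_atTop 0] with d hd
    exact (mul_pos hc hd).trans_le (hsum d)
  have hlim : Tendsto (fun d => K / (δ ^ 2 * c ^ 2) * (∑ k, w d k)⁻¹) atTop (𝓝 0) := by
    simpa using (tendsto_inv_atTop_zero.comp hw).const_mul (K / (δ ^ 2 * c ^ 2))
  refine tendsto_of_tendsto_of_tendsto_of_le_of_le' tendsto_const_nhds hlim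
    (Eventually.of_forall fun d => ?_) ?_
  · exact mul_nonneg (one_div_nonneg.2 (sumVar_nonneg d))
      (Finset.sum_nonneg fun k _ => tailSecondMoment_nonneg _ _)
  filter_upwards [hw.eventually_gt_atTop 0] with d hd
  have hpos : 0 < sumVar P Z d := (mul_pos hc hd).trans_le (hsum d)
  have hs : 0 < sumStd P Z d := Real.sqrt_pos.2 hpos
  have hs2 : sumStd P Z d ^ 2 = sumVar P Z d := Real.sq_sqrt hpos.le
  have hk k : ∫ ω, Set.indicator {ω | δ * sumStd P Z d ≤ |Z d k ω - ∫ ω', Z d k ω' ∂(P d)|}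
        (fun ω => (Z d k ω - ∫ ω', Z d k ω' ∂(P d)) ^ 2) ω ∂(P d)
      ≤ K * w d k / (δ ^ 2 * sumVar P Z d) := by
    refine le_trans ?_ (div_le_div_of_nonneg_right (hK d k) (by positivity))
    rw [← integral_div]
    refine integral_mono (integrable_indicator_sq ((hZ d k).sub (memLp_const _)) _)
      ((hint d k).div_const _) fun ω => ?_
    simp only [Set.indicator, Set.mem_ofPred_eq]
    split_ifs with h
    · rw [le_div_iff₀ (by positivity), ← hs2, ← mul_pow]
      have h2 := pow_le_pow_left₀ (by positivity) h 2
      rw [sq_abs] at h2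
      nlinarith [sq_nonneg (Z d k ω - ∫ ω', Z d k ω' ∂(P d))]
    · positivity
  have hKw : 0 ≤ K * ∑ k, w d k := by
    rw [Finset.mul_sum]
    exact Finset.sum_nonneg fun k _ =>
      (integral_nonneg fun ω => by positivity : (0 : ℝ) ≤ ∫ ω, _ ∂(P d)).trans (hK d k)
  calc _ ≤ 1 / sumVar P Z d * ∑ k, K * w d k / (δ ^ 2 * sumVar P Z d) := by
        gcongr with k
        exact hk k
    _ = K * (∑ k, w d k) / (δ ^ 2 * sumVar P Z d ^ 2) := by
        rw [← Finset.sum_div, ← Finset.mul_sum]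
        field_simp
    _ ≤ K * (∑ k, w d k) / (δ ^ 2 * (c * ∑ k, w d k) ^ 2) := by
        gcongr
        exact hsum d
    _ = _ := by
        field_simp

end TriangularArray

/-! ### Pólya's theorem -/

lemma continuous_cdf (ν : Measure ℝ) [IsProbabilityMeasure ν] [NullSingletonClass ν] :
    Continuous (cdf ν) := by
  rw [continuous_iff_continuousAt]
  intro x
  rw [(cdf ν).mono.continuousAt_iff_leftLim_eq_rightLim, StieltjesFunction.rightLim_eq]
  have h := (cdf ν).measure_singleton x
  rw [measure_cdf, measure_singleton, eq_comm, ENNReal.ofReal_eq_zero] at h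
  exact le_antisymm ((cdf ν).mono.leftLim_le le_rfl) (by linarith)

lemma exists_cdf_eq (ν : Measure ℝ) [IsProbabilityMeasure ν] [NullSingletonClass ν] {v : ℝ}
    (h0 : 0 < v) (h1 : v < 1) : ∃ a, cdf ν a = v :=
  mem_range_of_exists_le_of_exists_ge (continuous_cdf ν)
    (((tendsto_cdf_atBot ν).eventually_lt_const h0).exists.imp fun _ h => h.le)
    (((tendsto_cdf_atTop ν).eventually_const_lt h1).exists.imp fun _ h => h.le)

/-- **Pólya's theorem**, along an arbitrary sequence of points: monotone functions `F n` that
converge pointwise to the continuous distribution function of `ν` do so uniformly. -/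
lemma tendsto_sub_cdf_of_tendsto {F : ℕ → ℝ → ℝ} (hF : ∀ n, Monotone (F n))
    (h0 : ∀ n x, 0 ≤ F n x) (h1 : ∀ n x, F n x ≤ 1)
    (ν : Measure ℝ) [IsProbabilityMeasure ν] [NullSingletonClass ν]
    (h : ∀ a, Tendsto (fun n => F n a) atTop (𝓝 (cdf ν a))) (x : ℕ → ℝ) :
    Tendsto (fun n => F n (x n) - cdf ν (x n)) atTop (𝓝 0) := by
  rw [tendsto_iff_ultrafilter]
  intro U hU
  -- The numbers `cdf ν (x n)` lie in a compact interval, so they converge along `U`.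
  obtain ⟨u, hu, hUu⟩ := (isCompact_Icc (a := (0 : ℝ)) (b := 1)).ultrafilter_le_nhds
    (U.map fun n => cdf ν (x n)) (le_principal_iff.2 <| mem_map.2 <|
      Eventually.of_forall fun n => ⟨cdf_nonneg ν _, cdf_le_one ν _⟩)
  have hUu : Tendsto (fun n => cdf ν (x n)) U (𝓝 u) := hUu
  rw [show (0 : ℝ) = u - u by ring]
  refine Tendsto.sub (tendsto_order.2 ⟨fun v hv => ?_, fun v hv => ?_⟩) hUu
  · rcases lt_or_ge v 0 with hv0 | hv0
    · exact Eventually.of_forall fun n => hv0.trans_le (h0 _ _)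
    -- Compare `x n` with a fixed point `a` whose value `cdf ν a` lies strictly between `v` and `u`.
    obtain ⟨v', hv1, hv2⟩ := exists_between hv
    obtain ⟨a, ha⟩ := exists_cdf_eq ν (hv0.trans_lt hv1) (hv2.trans_le hu.2)
    filter_upwards [hUu.eventually_const_lt (ha.symm ▸ hv2),
      ((h a).mono_left hU).eventually_const_lt (ha.symm ▸ hv1)] with n hn1 hn2
    exact hn2.trans_le (hF n ((cdf ν).mono.reflect_lt hn1).le)
  · rcases lt_or_ge 1 v with hv0 | hv0
    · exact Eventually.of_forall fun n => (h1 _ _).trans_lt hv0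
    obtain ⟨v', hv1, hv2⟩ := exists_between hv
    obtain ⟨a, ha⟩ := exists_cdf_eq ν (hu.1.trans_lt hv1) (hv2.trans_le hv0)
    filter_upwards [hUu.eventually_lt_const (ha.symm ▸ hv1),
      ((h a).mono_left hU).eventually_lt_const (ha.symm ▸ hv2)] with n hn1 hn2
    exact (hF n ((cdf ν).mono.reflect_lt hn1).le).trans_lt hn2

instance nullSingletonClass_stdGaussian : NullSingletonClass (gaussianReal 0 1) :=
  nullSingletonClass_gaussianReal one_ne_zero

lemma gaussQ_eq_cdf_neg (x : ℝ) : gaussQ x = cdf (gaussianReal 0 1) (-x) := by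
  rw [cdf_eq_real, gaussQ]
  have h : (gaussianReal 0 1).map (fun x => -x) = gaussianReal 0 1 := by
    rw [gaussianReal_map_neg, neg_zero]
  have h2 : (gaussianReal 0 1).real (Set.Iic (-x)) = (gaussianReal 0 1).real (Set.Ici x) := by
    conv_lhs => rw [← h]
    rw [map_measureReal_apply measurable_neg measurableSet_Iic]
    congr 1
    ext y
    simp
  rw [h2]
  exact measureReal_congr Ioi_ae_eq_Ici

section Array

variable {Ω : ℕ → Type*} [∀ d, MeasurableSpace (Ω d)] {P : ∀ d, Measure (Ω d)}
  [∀ d, IsProbabilityMeasure (P d)] {Z : ∀ d, Fin d → Ω d → ℝ}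

/-- The row sum is negative exactly when its standardization is less than `-∑ m_k / s_d`, a
threshold that varies with `d`. -/
lemma CLT.tendsto_negSumProb_sub_cltApprox (h : CLT P Z)
    (hpos : ∀ᶠ d in atTop, 0 < sumVar P Z d) :
    Tendsto (fun d => negSumProb P Z d - cltApprox P Z d) atTop (𝓝 0) := by
  have hm := h.forall_aemeasurable
  have hp d : IsProbabilityMeasure
      ((P d).map fun ω => (∑ k, Z d k ω - sumMean P Z d) / sumStd P Z d) :=
    Measure.isProbabilityMeasure_map (hm d)
  have hF := tendsto_sub_cdf_of_tendsto
    (F := fun d x => ((P d).map fun ω => (∑ k, Z d k ω - sumMean P Z d) / sumStd P Z d).real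
      (Set.Iio x))
    (fun d x y hxy => measureReal_mono (Set.Iio_subset_Iio hxy))
    (fun _ _ => measureReal_nonneg) (fun _ _ => measureReal_le_one) (gaussianReal 0 1)
    (fun a => ?_) fun d => -(sumMean P Z d / sumStd P Z d)
  · refine hF.congr' ?_
    filter_upwards [hpos] with d hd
    have hs : 0 < sumStd P Z d := Real.sqrt_pos.2 hd
    rw [cltApprox, gaussQ_eq_cdf_neg, negSumProb, measureReal_def, measureReal_def,
      Measure.map_apply_of_aemeasurable (hm d) measurableSet_Iio]
    congr 4
    ext ω
    rw [Set.mem_preimage, Set.mem_Iio, Set.mem_ofPred_eq, ← neg_div, div_lt_div_iff_of_pos_right hs]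
    constructor <;> intro h <;> linarith
  · have := ProbabilityMeasure.tendsto_measure_of_null_frontier_of_tendsto' h.tendsto
      (E := Set.Iio a) (by simp [Measure.map_id])
    simp only [ProbabilityMeasure.coe_mk, Measure.map_id] at this
    have h2 := (ENNReal.tendsto_toReal (measure_ne_top (gaussianReal 0 1) _)).comp this
    rw [cdf_eq_real, measureReal_congr Iio_ae_eq_Iic.symm]
    exact h2

end Array

/-! ### Moment bounds for functions of the noise -/

/-- If `f` takes values at distance at least `2 r` on `A` and on `B`, then on one of the two sets it
stays at distance at least `r` from its mean. -/
lemma sq_mul_min_le_variance {ν : Measure ℝ} [IsProbabilityMeasure ν] {f : ℝ → ℝ}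
    (hf : MemLp f 2 ν) {r : ℝ} (hr : 0 ≤ r) {A B : Set ℝ}
    (h : ∀ x ∈ A, ∀ y ∈ B, 2 * r ≤ |f x - f y|) :
    r ^ 2 * min (ν.real A) (ν.real B) ≤ variance f ν := by
  have hi : Integrable (fun x => (f x - ∫ y, f y ∂ν) ^ 2) ν :=
    (hf.sub (memLp_const _)).integrable_sq
  have key : ∀ S : Set ℝ, (∀ x ∈ S, r ≤ |f x - ∫ y, f y ∂ν|) → r ^ 2 * ν.real S ≤ variance f ν := by
    intro S hS
    rw [variance_eq_integral hf.aestronglyMeasurable.aemeasurable]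
    refine le_trans ?_ (mul_meas_ge_le_integral_of_nonneg
      (ae_of_all _ fun x => sq_nonneg (f x - ∫ y, f y ∂ν)) hi (r ^ 2))
    refine mul_le_mul_of_nonneg_left (measureReal_mono fun x hx => ?_) (sq_nonneg r)
    have := pow_le_pow_left₀ hr (hS x hx) 2
    rwa [sq_abs] at this
  by_cases hA : ∀ x ∈ A, r ≤ |f x - ∫ y, f y ∂ν|
  · exact (mul_le_mul_of_nonneg_left (min_le_left _ _) (sq_nonneg r)).trans (key A hA)
  · push Not at hA
    obtain ⟨x, hx, hxr⟩ := hA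
    refine (mul_le_mul_of_nonneg_left (min_le_right _ _) (sq_nonneg r)).trans (key B fun y hy => ?_)
    have h1 := h x hx y hy
    have h2 := abs_sub_le (f x) (∫ y, f y ∂ν) (f y)
    rw [abs_sub_comm (∫ y, f y ∂ν) (f y)] at h2
    linarith

/-- A function dominated by `a * h` is in `L⁴`, with fourth central moment bounded by `a ^ 4` times
a constant that depends on `h` only. -/
lemma integral_sub_mean_pow_four_le {ν : Measure ℝ} [IsProbabilityMeasure ν] {f h : ℝ → ℝ}
    (hf : Measurable f) (hh : MemLp h 4 ν) {a : ℝ} (hfh : ∀ x, |f x| ≤ a * h x) :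
    MemLp f 4 ν ∧
      ∫ x, (f x - ∫ y, f y ∂ν) ^ 4 ∂ν ≤ a ^ 4 * ∫ x, (h x + ∫ y, h y ∂ν) ^ 4 ∂ν := by
  have hf4 : MemLp f 4 ν := (hh.const_mul a).mono' hf.aestronglyMeasurable (ae_of_all _ hfh)
  refine ⟨hf4, ?_⟩
  have hmean : |∫ y, f y ∂ν| ≤ a * ∫ y, h y ∂ν := by
    rw [← integral_const_mul]
    rw [← Real.norm_eq_abs]
    exact norm_integral_le_of_norm_le ((hh.integrable (by norm_num)).const_mul a)
      (ae_of_all _ hfh)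
  have e4 : Even 4 := by decide
  have h4 : ∀ g : ℝ → ℝ, MemLp g 4 ν → Integrable (fun x => g x ^ 4) ν := fun g hg => by
    have := hg.integrable_norm_pow (p := 4) (by norm_num)
    simpa only [Real.norm_eq_abs, e4.pow_abs] using this
  rw [← integral_const_mul]
  refine integral_mono (h4 _ (hf4.sub (memLp_const _)))
    ((h4 _ (hh.add (memLp_const _))).const_mul _) fun x => ?_
  have hb : |f x - ∫ y, f y ∂ν| ≤ a * (h x + ∫ y, h y ∂ν) := by
    have := abs_sub (f x) (∫ y, f y ∂ν)
    have := hfh x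
    linarith
  have := pow_le_pow_left₀ (abs_nonneg _) hb 4
  rwa [e4.pow_abs, mul_pow] at this

lemma memLp_one_add_sq_gaussianReal (v : NNReal) :
    MemLp (fun x : ℝ => 1 + x ^ 2) 4 (gaussianReal 0 v) := by
  have h8 : MemLp (id : ℝ → ℝ) (4 * 2) (gaussianReal 0 v) :=
    memLp_id_gaussianReal' _ (ENNReal.mul_ne_top (by simp) (by simp))
  have hs := h8.norm_rpow_div 2
  rw [ENNReal.mul_div_cancel_right (by simp) (by simp)] at hs
  refine (memLp_const (1 : ℝ)).add (hs.congr_norm (by fun_prop) (ae_of_all _ fun x => ?_))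
  simp

lemma gaussianReal_real_Icc_pos {v : NNReal} (hv : v ≠ 0) {a b : ℝ} (hab : a < b) :
    0 < (gaussianReal 0 v).real (Set.Icc a b) := by
  refine measureReal_nonneg.lt_of_ne' fun h => ?_
  rw [measureReal_eq_zero_iff] at h
  have := gaussianReal_absolutelyContinuous' 0 hv h
  rw [Real.volume_Icc, ENNReal.ofReal_eq_zero] at this
  linarith

section Array

variable {Ω : ℕ → Type*} [∀ d, MeasurableSpace (Ω d)] {P : ∀ d, Measure (Ω d)}
  [∀ d, IsProbabilityMeasure (P d)] {N : ∀ d, Fin d → Ω d → ℝ}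

/-- Lindeberg's condition for functions `f d k` of noise variables with a common law `ν`, where
`f d k` is dominated by `a d k` times a fixed function in `L⁴`. -/
lemma lindeberg_of_hasLaw {ν : Measure ℝ} [IsProbabilityMeasure ν]
    (hN : ∀ d k, HasLaw (N d k) ν (P d)) {f : ∀ d, Fin d → ℝ → ℝ} (hf : ∀ d k, Measurable (f d k))
    {h : ℝ → ℝ} (hh : MemLp h 4 ν) {a w : ∀ d, Fin d → ℝ} (hfh : ∀ d k x, |f d k x| ≤ a d k * h x)
    {c K : ℝ} (hc : 0 < c) (ha : ∀ d k, a d k ^ 4 ≤ K * w d k)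
    (hvar : ∀ d k, MemLp (f d k) 2 ν → c * w d k ≤ variance (f d k) ν)
    (hw : Tendsto (fun d => ∑ k, w d k) atTop atTop) :
    Lindeberg P (fun d k ω => f d k (N d k ω)) := by
  have h4 d k := integral_sub_mean_pow_four_le (hf d k) hh (hfh d k)
  have h2 d k : MemLp (f d k) 2 ν := (h4 d k).1.mono_exponent (by norm_num)
  have hcomp {p d k} {g : ℝ → ℝ} (hg : MemLp g p ν) : MemLp (fun ω => g (N d k ω)) p (P d) := by
    rw [← (hN d k).map_eq] at hg
    exact hg.comp_of_map (hN d k).aemeasurable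
  have hmean d k : ∫ ω, f d k (N d k ω) ∂(P d) = ∫ x, f d k x ∂ν :=
    (hN d k).integral_comp (hf d k).aestronglyMeasurable
  have hm d k : Measurable fun x => (f d k x - ∫ y, f d k y ∂ν) ^ 4 := by
    have := hf d k
    fun_prop
  refine lindeberg_of_fourth_moment_le (w := w) (c := c)
    (K := K * ∫ x, (h x + ∫ y, h y ∂ν) ^ 4 ∂ν) (fun d k => hcomp (h2 d k)) hw hc
    (fun d k => ?_) (fun d k => ?_) (fun d k => ?_)
  · refine (hvar d k (h2 d k)).trans_eq ?_
    rw [variance_eq_integral (h2 d k).aestronglyMeasurable.aemeasurable,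
      variance_eq_integral (hcomp (h2 d k)).aestronglyMeasurable.aemeasurable, hmean]
    exact ((hN d k).integral_comp (f := fun x => (f d k x - ∫ y, f d k y ∂ν) ^ 2)
      (((hf d k).sub_const _).pow_const 2).aestronglyMeasurable).symm
  · rw [hmean]
    have hi := (hcomp (d := d) (k := k) ((h4 d k).1.sub (memLp_const
      (∫ y, f d k y ∂ν)))).integrable_norm_pow (p := 4) (by norm_num)
    have e4 : Even 4 := by decide
    simpa only [Real.norm_eq_abs, e4.pow_abs, Pi.sub_apply] using hi
  · rw [hmean]
    refine ((hN d k).integral_comp (hm d k).aestronglyMeasurable).trans_le ((h4 d k).2.trans ?_)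
    rw [mul_right_comm]
    exact mul_le_mul_of_nonneg_right (ha d k) (integral_nonneg fun x => by positivity)

end Array

/-! ### The cost differences and their lower bounds, coordinate by coordinate -/

lemma doubleSidedReLU_sq {ε : ℝ} (hε : 0 ≤ ε) (x : ℝ) :
    doubleSidedReLU ε x ^ 2 = max 0 (|x| - ε) ^ 2 := by
  rcases lt_trichotomy x 0 with h | rfl | h
  · simp [doubleSidedReLU, Real.sign_of_neg h]
  · simp [doubleSidedReLU, hε]
  · simp [doubleSidedReLU, Real.sign_of_pos h]

lemma abs_doubleSidedReLU_sq_sub_le {ε : ℝ} (hε : 0 ≤ ε) (x y : ℝ) :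
    |doubleSidedReLU ε x ^ 2 - doubleSidedReLU ε y ^ 2| ≤ |x - y| * (|x| + |y|) := by
  rw [doubleSidedReLU_sq hε, doubleSidedReLU_sq hε, sq_sub_sq, abs_mul, mul_comm]
  refine mul_le_mul ?_ ?_ (abs_nonneg _) (abs_nonneg _)
  · have := abs_max_sub_max_le_max 0 (|x| - ε) 0 (|y| - ε)
    rw [sub_self, abs_zero, sub_sub_sub_cancel_right, max_eq_right (abs_nonneg (|x| - |y|))] at this
    exact this.trans (abs_abs_sub_abs_le x y)
  · have h (z : ℝ) : max 0 (|z| - ε) ≤ |z| := max_le (abs_nonneg z) (by linarith)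
    rw [abs_of_nonneg (add_nonneg (le_max_left _ _) (le_max_left _ _))]
    exact add_le_add (h x) (h y)

lemma measurable_coordLower (ε μ : ℝ) : Measurable (coordLower ε μ) := by
  unfold coordLower
  exact (Measurable.ite measurableSet_Ici (by fun_prop) measurable_const).sub (by fun_prop)

lemma measurable_coordCostDiff {ε : ℝ} (hε : 0 ≤ ε) (μ : ℝ) : Measurable (coordCostDiff ε μ) := by
  unfold coordCostDiff
  simp only [doubleSidedReLU_sq hε]
  fun_prop

lemma coordLower_abs (ε μ n : ℝ) : coordLower ε |μ| n = coordLower ε μ n := by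
  have h : shift ε |μ| = shift ε μ := by rw [shift, shift, abs_abs]
  simp only [coordLower, h]

lemma abs_coordLower_le {ε μ T : ℝ} (hT : |shift ε μ| ≤ T) (n : ℝ) :
    |coordLower ε μ n| ≤ (2 * T ^ 2 + 2) * (1 + n ^ 2) := by
  have h1 : shift ε μ ^ 2 ≤ T ^ 2 := by
    rw [← sq_abs]
    exact pow_le_pow_left₀ (abs_nonneg _) hT 2
  have h2 : 0 ≤ T ^ 2 * n ^ 2 := by positivity
  unfold coordLower
  split_ifs <;> rw [abs_le] <;> constructor <;>
    nlinarith [sq_nonneg (shift ε μ + n), sq_nonneg (shift ε μ - n), sq_nonneg n, sq_nonneg T]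

lemma coordLower_of_lt {ε μ n : ℝ} (h : n < -shift ε μ) : coordLower ε μ n = -n ^ 2 := by
  simp [coordLower, not_le.2 h]

lemma abs_coordCostDiff_le {ε : ℝ} (hε : 0 ≤ ε) {μ M : ℝ} (hM : |μ| ≤ M) (n : ℝ) :
    |coordCostDiff ε μ n| ≤ |μ| * (4 * M + 4 * ε + 4) * (1 + n ^ 2) := by
  have hs : |ε * Real.sign μ| ≤ ε := by
    rw [abs_mul, abs_of_nonneg hε]
    refine mul_le_of_le_one_right hε ?_
    rcases Real.sign_apply_eq μ with h | h | h <;> simp [h]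
  refine (abs_doubleSidedReLU_sq_sub_le hε _ _).trans ?_
  have h1 : |2 * μ - ε * Real.sign μ + n| ≤ 2 * |μ| + ε + |n| := by
    refine (abs_add_le _ _).trans (add_le_add_left ((abs_sub _ _).trans (add_le_add ?_ hs)) _)
    rw [abs_mul, abs_two]
  have h2 : |-(ε * Real.sign μ) + n| ≤ ε + |n| := by
    refine (abs_add_le _ _).trans (add_le_add_left ?_ _)
    rwa [abs_neg]
  have h3 : |2 * μ - ε * Real.sign μ + n - (-(ε * Real.sign μ) + n)| = 2 * |μ| := by
    rw [← abs_two, ← abs_mul]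
    congr 1
    rw [abs_two]
    ring
  have hn : |n| ≤ 1 + n ^ 2 := by rw [← sq_abs]; nlinarith [sq_nonneg (|n| - 1)]
  rw [h3, mul_comm 2, mul_assoc, mul_assoc]
  refine mul_le_mul_of_nonneg_left ?_ (abs_nonneg _)
  have hM0 : 0 ≤ M := (abs_nonneg _).trans hM
  have : 0 ≤ (4 * M + 4 * ε) * n ^ 2 := by positivity
  nlinarith

lemma doubleSidedReLU_sq_of_le {ε x : ℝ} (hε : 0 ≤ ε) (hx : ε ≤ x) :
    doubleSidedReLU ε x ^ 2 = (x - ε) ^ 2 := by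
  rw [doubleSidedReLU_sq hε, abs_of_nonneg (hε.trans hx), max_eq_right (sub_nonneg.2 hx)]

lemma coordCostDiff_of_two_mul_le {ε μ n : ℝ} (hε : 0 ≤ ε) (hμ : 0 < μ) (hn : 2 * ε ≤ n) :
    coordCostDiff ε μ n = 4 * μ * (μ + n - 2 * ε) := by
  rw [coordCostDiff, Real.sign_of_pos hμ, doubleSidedReLU_sq_of_le hε (by linarith),
    doubleSidedReLU_sq_of_le hε (by linarith)]
  ring

lemma coordLower_le_coordCostDiff {ε μ : ℝ} (hε : 0 ≤ ε) (hμ : 0 ≤ μ) (n : ℝ) :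
    coordLower ε μ n ≤ coordCostDiff ε μ n := by
  rcases hμ.eq_or_lt with rfl | hμ
  · have : coordCostDiff ε 0 n = 0 := by simp [coordCostDiff]
    rw [this]
    simp only [coordLower, shift, abs_zero]
    split_ifs with h <;> nlinarith [sq_nonneg n]
  · rw [coordCostDiff, coordLower, Real.sign_of_pos hμ, mul_one]
    have h1 : doubleSidedReLU ε (-ε + n) ^ 2 ≤ n ^ 2 := by
      rw [doubleSidedReLU_sq hε, ← sq_abs n]
      refine pow_le_pow_left₀ (le_max_left _ _) (max_le (abs_nonneg _) ?_) 2
      have := abs_add_le (-ε) n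
      rw [abs_neg, abs_of_nonneg hε] at this
      linarith
    split_ifs with h
    · simp only [shift, abs_of_pos hμ] at h ⊢
      rw [doubleSidedReLU_sq_of_le hε (x := 2 * μ - ε + n) (by linarith)]
      nlinarith
    · have := sq_nonneg (doubleSidedReLU ε (2 * μ - ε + n))
      linarith

/-- The sign `±1` that turns a mean `μ` into `|μ|`. -/
noncomputable def flipSign (μ : ℝ) : ℝ := if μ < 0 then -1 else 1

/-- The cost difference is invariant under a simultaneous reflection of mean and noise. -/
lemma coordCostDiff_abs_flipSign {ε : ℝ} (hε : 0 ≤ ε) (μ n : ℝ) :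
    coordCostDiff ε |μ| (flipSign μ * n) = coordCostDiff ε μ n := by
  rw [flipSign]
  split_ifs with h
  · simp only [coordCostDiff, doubleSidedReLU_sq hε, abs_of_neg h, Real.sign_of_neg h,
      Real.sign_of_pos (neg_pos.2 h)]
    congr 4
    · rw [← abs_neg]; congr 1; ring
    · rw [← abs_neg]; congr 1; ring
  · rw [abs_of_nonneg (not_lt.1 h), one_mul]

lemma hasLaw_flipSign_mul {Ω : Type*} [MeasurableSpace Ω] {P : Measure Ω} {X : Ω → ℝ} {v : NNReal}
    (hX : HasLaw X (gaussianReal 0 v) P) (μ : ℝ) :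
    HasLaw (fun ω => flipSign μ * X ω) (gaussianReal 0 v) P := by
  rw [flipSign]
  split_ifs
  · simpa only [neg_one_mul, neg_zero] using! gaussianReal_neg hX
  · simpa using hX

/-! ### The arrays of lower bounds and of cost differences -/

section Array

variable {Ω : ℕ → Type*} [∀ d, MeasurableSpace (Ω d)] {P : ∀ d, Measure (Ω d)}
  {N : ∀ d, Fin d → Ω d → ℝ} {μ : ∀ d, Fin d → ℝ}
  {ε M : ℝ} {v : NNReal}

lemma iIndepFun_lowerVar (hN : ∀ d, iIndepFun (N d) (P d)) (d : ℕ) :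
    iIndepFun (lowerVar ε μ N d) (P d) :=
  (hN d).comp (fun k => coordLower ε (μ d k)) fun _ => measurable_coordLower _ _

lemma iIndepFun_costDiffVar (hε : 0 ≤ ε) (hN : ∀ d, iIndepFun (N d) (P d)) (d : ℕ) :
    iIndepFun (costDiffVar ε μ N d) (P d) :=
  (hN d).comp (fun k => coordCostDiff ε (μ d k)) fun _ => measurable_coordCostDiff hε _

lemma errorProb_eq_negSumProb_costDiffVar (d : ℕ) :
    errorProb P ε μ N d = negSumProb P (costDiffVar ε μ N) d := by
  rw [errorProb, negSumProb]
  congr 1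
  ext ω
  have h : ∑ k, costDiffVar ε μ N d k ω
      = cost ε (observation ε (μ d) fun k => N d k ω) (fun k => -μ d k)
        - cost ε (observation ε (μ d) fun k => N d k ω) (μ d) := by
    rw [cost, cost, ← Finset.sum_sub_distrib]
    refine Finset.sum_congr rfl fun k _ => ?_
    simp only [costDiffVar, coordCostDiff, observation]
    congr 3 <;> ring
  simp only [Set.mem_ofPred_eq, h, sub_neg]

variable [∀ d, IsProbabilityMeasure (P d)]

/-- The pointwise domination holds after reflecting the noise in the coordinates with negative mean,
which leaves its joint law unchanged. -/
lemma errorProb_le_negSumProb_lowerVar (hε : 0 ≤ ε)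
    (hlaw : ∀ d k, HasLaw (N d k) (gaussianReal 0 v) (P d)) (hN : ∀ d, iIndepFun (N d) (P d))
    (d : ℕ) : errorProb P ε μ N d ≤ negSumProb P (lowerVar ε μ N) d := by
  have hflip : iIndepFun (fun k ω => flipSign (μ d k) * N d k ω) (P d) :=
    (hN d).comp (fun k x => flipSign (μ d k) * x) fun k => by fun_prop
  have hL1 := (hN d).hasLaw_pi (hlaw d)
  have hL2 := hflip.hasLaw_pi fun k => hasLaw_flipSign_mul (hlaw d k) (μ d k)
  have hS : MeasurableSet {x : Fin d → ℝ | ∑ k, coordLower ε (μ d k) (x k) < 0} :=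
    measurableSet_lt (Finset.measurable_sum _ fun k _ =>
      (measurable_coordLower ε (μ d k)).comp (measurable_pi_apply k)) measurable_const
  rw [errorProb_eq_negSumProb_costDiffVar]
  calc negSumProb P (costDiffVar ε μ N) d
      ≤ (P d).real {ω | ∑ k, coordLower ε (μ d k) (flipSign (μ d k) * N d k ω) < 0} := by
        refine measureReal_mono fun ω (hω : ∑ k, costDiffVar ε μ N d k ω < 0) => ?_
        refine (show ∑ k, _ ≤ _ from Finset.sum_le_sum fun k _ => ?_).trans_lt hω
        rw [costDiffVar, ← coordCostDiff_abs_flipSign hε, ← coordLower_abs]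
        exact coordLower_le_coordCostDiff hε (abs_nonneg _) _
    _ = negSumProb P (lowerVar ε μ N) d := (hL2.measureReal_eq hS).trans (hL1.measureReal_eq hS).symm

/-- On two fixed intervals far to the left `Y_k` equals `-N_k²`, whence a lower bound for its
variance that is uniform in the mean. -/
lemma lindeberg_lowerVar (hv : v ≠ 0) (hlaw : ∀ d k, HasLaw (N d k) (gaussianReal 0 v) (P d))
    (hε : 0 ≤ ε) (hM : ∀ d k, |μ d k| ≤ M) : Lindeberg P (lowerVar ε μ N) := by
  obtain ⟨T, hT0, hT⟩ : ∃ T : ℝ, 0 ≤ T ∧ ∀ d k, |shift ε (μ d k)| ≤ T := by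
    refine ⟨2 * (|M| + ε), by positivity, fun d k => ?_⟩
    have h1 := (hM d k).trans (le_abs_self M)
    have h2 := abs_nonneg (μ d k)
    rw [shift, abs_le]
    constructor <;> linarith
  refine lindeberg_of_hasLaw hlaw (f := fun d k => coordLower ε (μ d k))
    (fun d k => measurable_coordLower _ _) (memLp_one_add_sq_gaussianReal v)
    (fun d k x => abs_coordLower_le (hT d k) x) (w := fun _ _ => 1) (K := (2 * T ^ 2 + 2) ^ 4)
    (lt_min (gaussianReal_real_Icc_pos hv (show -(T + 2) < -(T + 1) by linarith))
      (gaussianReal_real_Icc_pos hv (show -(T + 4) < -(T + 3) by linarith)))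
    (fun d k => by simp) (fun d k hf => ?_) ?_
  · have := sq_mul_min_le_variance hf (r := 1) zero_le_one
      (A := Set.Icc (-(T + 2)) (-(T + 1))) (B := Set.Icc (-(T + 4)) (-(T + 3))) ?_
    · simpa using this
    rintro x ⟨hx1, hx2⟩ y ⟨hy1, hy2⟩
    have ht := (le_abs_self _).trans (hT d k)
    rw [coordLower_of_lt (by linarith), coordLower_of_lt (by linarith)]
    refine le_trans ?_ (le_abs_self _)
    nlinarith
  · simpa using tendsto_natCast_atTop_atTop

/-- The weights are `μ_k²`: at noise values `x`, `y` above `2 ε` the cost differences of a coordinate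
with mean `μ > 0` differ by `4 μ (x - y)`. -/
lemma lindeberg_costDiffVar_of_nonneg (hv : v ≠ 0)
    (hlaw : ∀ d k, HasLaw (N d k) (gaussianReal 0 v) (P d))
    (hε : 0 ≤ ε) (hμ : ∀ d k, 0 ≤ μ d k) (hM : ∀ d k, |μ d k| ≤ M)
    (hdiv : Tendsto (fun d => ∑ k, μ d k ^ 2) atTop atTop) :
    Lindeberg P (costDiffVar ε μ N) := by
  have hc : 0 < 4 * min ((gaussianReal 0 v).real (Set.Icc (2 * ε) (2 * ε + 1)))
      ((gaussianReal 0 v).real (Set.Icc (2 * ε + 2) (2 * ε + 3))) :=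
    mul_pos four_pos (lt_min (gaussianReal_real_Icc_pos hv (by linarith))
      (gaussianReal_real_Icc_pos hv (by linarith)))
  refine lindeberg_of_hasLaw hlaw (f := fun d k => coordCostDiff ε (μ d k))
    (fun d k => measurable_coordCostDiff hε _) (memLp_one_add_sq_gaussianReal v)
    (fun d k x => abs_coordCostDiff_le hε (hM d k) x) (w := fun d k => μ d k ^ 2)
    (K := M ^ 2 * (4 * M + 4 * ε + 4) ^ 4) hc (fun d k => ?_) (fun d k hf => ?_) hdiv
  · have h1 : |μ d k| ^ 4 ≤ M ^ 2 * μ d k ^ 2 := by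
      rw [← sq_abs (μ d k), show 4 = 2 + 2 by norm_num, pow_add]
      exact mul_le_mul_of_nonneg_right (pow_le_pow_left₀ (abs_nonneg _) (hM d k) 2) (sq_nonneg _)
    rw [mul_pow, mul_right_comm]
    exact mul_le_mul_of_nonneg_right h1 (by positivity)
  · rcases (hμ d k).eq_or_lt with h0 | h0
    · rw [← h0]
      simp [variance_nonneg]
    have := sq_mul_min_le_variance hf (r := 2 * μ d k) (by linarith)
      (A := Set.Icc (2 * ε + 2) (2 * ε + 3)) (B := Set.Icc (2 * ε) (2 * ε + 1)) ?_
    · rw [min_comm] at this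
      linarith
    rintro x ⟨hx1, hx2⟩ y ⟨hy1, hy2⟩
    rw [coordCostDiff_of_two_mul_le hε h0 (by linarith),
      coordCostDiff_of_two_mul_le hε h0 (by linarith)]
    refine le_trans ?_ (le_abs_self _)
    nlinarith

/-- Reflecting the noise in the coordinates with negative mean makes all means nonnegative. -/
lemma lindeberg_costDiffVar (hv : v ≠ 0) (hlaw : ∀ d k, HasLaw (N d k) (gaussianReal 0 v) (P d))
    (hε : 0 ≤ ε) (hM : ∀ d k, |μ d k| ≤ M)
    (hdiv : Tendsto (fun d => ∑ k, μ d k ^ 2) atTop atTop) :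
    Lindeberg P (costDiffVar ε μ N) := by
  have h := lindeberg_costDiffVar_of_nonneg (μ := fun d k => |μ d k|) (M := M) hv
    (fun d k => hasLaw_flipSign_mul (hlaw d k) (μ d k)) hε (fun _ _ => abs_nonneg _)
    (fun d k => by simpa using hM d k) (by simpa using hdiv)
  have e : costDiffVar ε μ N
      = costDiffVar ε (fun d k => |μ d k|) fun d k ω => flipSign (μ d k) * N d k ω := by
    funext d k ω
    exact (coordCostDiff_abs_flipSign hε _ _).symm
  rwa [e]

end Array

end GLRT

theorem proposition1 {Ω : ℕ → Type*} [∀ d, MeasurableSpace (Ω d)]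
    (P : ∀ d, Measure (Ω d)) [∀ d, IsProbabilityMeasure (P d)]
    (σ ε : ℝ) (hσ : 0 < σ) (hε : 0 ≤ ε)
    (μ : ∀ d, Fin d → ℝ) (N : ∀ d, Fin d → Ω d → ℝ)
    (hN_law : ∀ d k, HasLaw (N d k) (gaussianReal 0 (σ ^ 2).toNNReal) (P d))
    (hN_indep : ∀ d, iIndepFun (N d) (P d)) :
    (∀ d, iIndepFun (GLRT.lowerVar ε μ N d) (P d)) ∧
    (∀ d, GLRT.errorProb P ε μ N d ≤ GLRT.negSumProb P (GLRT.lowerVar ε μ N) d) ∧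
    (GLRT.Lindeberg P (GLRT.lowerVar ε μ N) → GLRT.CLT P (GLRT.lowerVar ε μ N)) ∧
    ((∃ M : ℝ, ∀ d k, |μ d k| ≤ M) →
      (GLRT.Lindeberg P (GLRT.lowerVar ε μ N) ∧
        GLRT.CLT P (GLRT.lowerVar ε μ N) ∧
        Tendsto (fun d => GLRT.negSumProb P (GLRT.lowerVar ε μ N) d -
          GLRT.cltApprox P (GLRT.lowerVar ε μ N) d) atTop (𝓝 0)) ∧
      (Tendsto (fun d => ∑ k, μ d k ^ 2) atTop atTop →
        GLRT.Lindeberg P (GLRT.costDiffVar ε μ N) ∧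
        GLRT.CLT P (GLRT.costDiffVar ε μ N) ∧
        Tendsto (fun d => GLRT.errorProb P ε μ N d -
          GLRT.cltApprox P (GLRT.costDiffVar ε μ N) d) atTop (𝓝 0))) := by
  have hv : (σ ^ 2).toNNReal ≠ 0 := by simpa using hσ.ne'
  have hY : GLRT.Lindeberg P (GLRT.lowerVar ε μ N) → GLRT.CLT P (GLRT.lowerVar ε μ N) :=
    fun h => h.clt (GLRT.iIndepFun_lowerVar hN_indep)
  refine ⟨GLRT.iIndepFun_lowerVar hN_indep,
    GLRT.errorProb_le_negSumProb_lowerVar hε hN_law hN_indep, hY, ?_⟩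
  rintro ⟨M, hM⟩
  have hL := GLRT.lindeberg_lowerVar hv hN_law hε hM
  refine ⟨⟨hL, hY hL, (hY hL).tendsto_negSumProb_sub_cltApprox hL.sumVar_pos⟩, fun hdiv => ?_⟩
  have hLC := GLRT.lindeberg_costDiffVar hv hN_law hε hM hdiv
  have hC := hLC.clt (GLRT.iIndepFun_costDiffVar hε hN_indep)
  refine ⟨hLC, hC, ?_⟩
  simp only [GLRT.errorProb_eq_negSumProb_costDiffVar]
  exact hC.tendsto_negSumProb_sub_cltApprox hLC.sumVar_pos
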